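/- Let $G$ be a second-countable Hausdorff topological group with neutral element $e$. Let $\mathrm{RUCB}(G)$ be the Banach space, with the supremum norm, of all bounded functions $f\colon G\to\mathbb{C}$ that are right-uniformly continuous: for every $\varepsilon>0$ there is a neighbourhood $U$ of $e$ such that $|f(x)-f(y)|\le\varepsilon$ whenever $xy^{-1}\in U$. Let $\mathrm{M}(G)$ be the set of means, i.e. of all $m\in\mathrm{RUCB}(G)^{*}$ that are positive and satisfy $m(\mathbf 1)=1$. For $g\in G$ put $\lambda_g(x)=gx$. The group $G$ is amenable if there is $m\in\mathrm{M}(G)$ with $m(f\circ\lambda_g)=m(f)$ for all $g\in G$ and $f\in\mathrm{RUCB}(G)$. A set $H\subseteq\mathrm{RUCB}(G)$ is UEB if $\sup_{f\in H}\|f\|_\infty<\infty$ and for every $\varepsilon>0$ there is a neighbourhood $U$ of $e$ such that $|f(x)-f(y)|\le\varepsilon$ for all $f\in H$ and all $x,y\in G$ with $xy^{-1}\in U$. A sequence $(m_n)_{n\in\mathbb{N}}$ in $\mathrm{M}(G)$ UEB-converges to invariance over $G$ if, for every $g\in G$ and every UEB set $H$, $\sup_{f\in H}|m_n(f\circ\lambda_g)-m_n(f)|\to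 0$ as $n\to\infty$. A Borel probability measure $\mu$ on $G$ is identified with the mean $f\mapsto\int f\,d\mu$; it is fully supported if $\mu(U)>0$ for every non-empty open $U\subseteq G$, and regular if $\mu(B)=\sup\{\mu(K): K\subseteq B\text{ compact}\}$ for every Borel set $B$. Finally, $\mu^{n}$ denotes the $n$-th convolution power of $\mu$, where the convolution $\mu\nu$ is the image of $\mu\otimes\nu$ under $(x,y)\mapsto xy$, and $\mu^{0}=\delta_e$. Then the following statements are equivalent. 1. $G$ is amenable. 2. $G$ admits a fully supported, regular Borel probability measure $\mu$ such that $(\mu^{n})_{n\in\mathbb{N}}$ UEB-converges to invariance over $G$. 3. $G$ admits a Borel probability measure $\mu$ such that $(\mu^{n})_{n\in\mathbb{N}}$ UEB-converges to invariance over $G$. -/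

import Mathlib

open Filter Topology MeasureTheory
open scoped ComplexOrder BoundedContinuousFunction

noncomputable section

namespace TopGroupAmenability

/-- A set `H` of complex functions on `G` is right-uniformly equicontinuous. -/
def RightUniformEquicontinuous {G : Type*} [Group G] [TopologicalSpace G]
    (H : Set (G → ℂ)) : Prop :=
  ∀ ε : ℝ, 0 < ε → ∃ U ∈ 𝓝 (1 : G), ∀ f ∈ H, ∀ x y : G, x * y⁻¹ ∈ U → ‖f x - f y‖ ≤ ε

/-- Right-uniform continuity of a complex function on `G`. -/
def RightUniformContinuous {G : Type*} [Group G] [TopologicalSpace G] (f : G → ℂ) : Prop :=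
  ∀ ε : ℝ, 0 < ε → ∃ U ∈ 𝓝 (1 : G), ∀ x y : G, x * y⁻¹ ∈ U → ‖f x - f y‖ ≤ ε

/-- Right-uniformly continuous functions are continuous, so that taking `RUCB G` inside the
bounded continuous functions loses nothing. -/
theorem RightUniformContinuous.continuous {G : Type*} [Group G] [TopologicalSpace G]
    [IsTopologicalGroup G] {f : G → ℂ} (hf : RightUniformContinuous f) : Continuous f := by
  rw [continuous_iff_continuousAt]
  intro y
  rw [ContinuousAt, Metric.tendsto_nhds]
  intro ε hε
  obtain ⟨U, hU, h⟩ := hf (ε / 2) (half_pos hε)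
  have ht : Tendsto (fun x : G => x * y⁻¹) (𝓝 y) (𝓝 1) := by
    have : Continuous fun x : G => x * y⁻¹ := by fun_prop
    simpa using this.tendsto y
  filter_upwards [ht hU] with x hx
  rw [dist_eq_norm]
  exact (h x y hx).trans_lt (half_lt_self hε)

/-- The space `RUCB(G)` of right-uniformly continuous bounded complex functions on `G`, with
pointwise operations and the supremum norm, as a unital star-subalgebra of `G →ᵇ ℂ`. -/
def RUCB (G : Type*) [Group G] [TopologicalSpace G] [IsTopologicalGroup G] :
    StarSubalgebra ℂ (G →ᵇ ℂ) where
  carrier := {f | RightUniformContinuous (f : G → ℂ)}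
  mul_mem' := by
    intro f g hf hg ε hε
    have hc : 0 < ‖f‖ + ‖g‖ + 1 := by positivity
    obtain ⟨U, hU, hfU⟩ := hf (ε / (‖f‖ + ‖g‖ + 1)) (div_pos hε hc)
    obtain ⟨V, hV, hgV⟩ := hg (ε / (‖f‖ + ‖g‖ + 1)) (div_pos hε hc)
    refine ⟨U ∩ V, inter_mem hU hV, fun x y hxy => ?_⟩
    have h1 := hfU x y hxy.1
    have h2 := hgV x y hxy.2
    have e : (f * g) x - (f * g) y = f x * (g x - g y) + (f x - f y) * g y := by
      simp only [BoundedContinuousFunction.coe_mul, Pi.mul_apply]; ring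
    rw [e]
    refine (norm_add_le _ _).trans ?_
    rw [norm_mul, norm_mul]
    set δ := ε / (‖f‖ + ‖g‖ + 1) with hδ
    have hδ0 : 0 < δ := div_pos hε hc
    have h3 : ‖f x‖ * ‖g x - g y‖ ≤ ‖f‖ * δ := by gcongr; exact f.norm_coe_le_norm x
    have h4 : ‖f x - f y‖ * ‖g y‖ ≤ δ * ‖g‖ := by gcongr; exact g.norm_coe_le_norm y
    have h5 : δ * (‖f‖ + ‖g‖ + 1) = ε := by rw [hδ]; field_simp
    nlinarith
  add_mem' := by
    intro f g hf hg ε hε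
    obtain ⟨U, hU, hfU⟩ := hf (ε / 2) (half_pos hε)
    obtain ⟨V, hV, hgV⟩ := hg (ε / 2) (half_pos hε)
    refine ⟨U ∩ V, inter_mem hU hV, fun x y hxy => ?_⟩
    have h1 := hfU x y hxy.1
    have h2 := hgV x y hxy.2
    have e : (f + g) x - (f + g) y = (f x - f y) + (g x - g y) := by
      simp only [BoundedContinuousFunction.coe_add, Pi.add_apply]; ring
    rw [e]
    exact (norm_add_le _ _).trans (by linarith)
  algebraMap_mem' := by
    intro c ε hε
    exact ⟨Set.univ, univ_mem, fun x y _ => by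
      simpa [BoundedContinuousFunction.algebraMap_apply] using hε.le⟩
  star_mem' := by
    intro f hf ε hε
    obtain ⟨U, hU, h⟩ := hf ε hε
    refine ⟨U, hU, fun x y hxy => ?_⟩
    have := h x y hxy
    simp only [BoundedContinuousFunction.star_apply]
    rwa [← star_sub, norm_star]

section

variable {G : Type*} [Group G] [TopologicalSpace G] [IsTopologicalGroup G]

/-- The left translate `f ∘ λ_g`, where `λ_g x = g * x`, of a function `f ∈ RUCB(G)`. -/
def leftTranslate (g : G) (f : RUCB G) : RUCB G :=
  ⟨(f : G →ᵇ ℂ).compContinuous ⟨fun x => g * x, by fun_prop⟩, by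
    intro ε hε
    obtain ⟨U, hU, h⟩ := f.2 ε hε
    refine ⟨(fun x => g * x * g⁻¹) ⁻¹' U, ?_, fun x y hxy => ?_⟩
    · have hc : Continuous fun x : G => g * x * g⁻¹ := by fun_prop
      exact hc.continuousAt.preimage_mem_nhds (by simpa using hU)
    · refine h (g * x) (g * y) ?_
      simpa [mul_assoc] using hxy⟩

@[simp]
theorem leftTranslate_apply (g : G) (f : RUCB G) (x : G) :
    (leftTranslate g f : G →ᵇ ℂ) x = (f : G →ᵇ ℂ) (g * x) := rfl

/-- `H ∈ RUEB(G)`: the set `H ⊆ RUCB(G)` is bounded in the supremum norm and right-uniformly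
equicontinuous. -/
def IsUEB (H : Set (RUCB G)) : Prop :=
  (∃ C : ℝ, ∀ f ∈ H, ‖f‖ ≤ C) ∧
    RightUniformEquicontinuous ((fun f : RUCB G => ((f : G →ᵇ ℂ) : G → ℂ)) '' H)

variable (G) in
/-- The set `M(G)` of means: positive unital functionals in the dual Banach space of
`RUCB(G)`. -/
def Means : Set (RUCB G →L[ℂ] ℂ) :=
  {m | (∀ f : RUCB G, (∀ x : G, 0 ≤ (f : G →ᵇ ℂ) x) → 0 ≤ m f) ∧ m 1 = 1}

variable (G) in
/-- `G` is amenable if `M(G)` has a fixed point for the action `(g m)(f) = m (f ∘ λ_g)`. -/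
def IsAmenable : Prop :=
  ∃ m ∈ Means G, ∀ (g : G) (f : RUCB G), m (leftTranslate g f) = m f

/-- A family `m` of means UEB-converges to invariance along the filter `l`. The supremum is taken
in `[0, ∞]`. -/
def UEBConvergesToInvariance {ι : Type*} (l : Filter ι) (m : ι → Means G) : Prop :=
  ∀ (g : G) (H : Set (RUCB G)), IsUEB H →
    Tendsto (fun i => ⨆ f ∈ H, ‖(m i).1 (leftTranslate g f) - (m i).1 f‖ₑ) l (𝓝 0)

section Measure

variable [MeasurableSpace G] [BorelSpace G]

/-- The functional `f ↦ ∫ f dμ` on `RUCB(G)`. -/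
def integralFunctional (μ : ProbabilityMeasure G) : RUCB G →L[ℂ] ℂ :=
  LinearMap.mkContinuous
    { toFun := fun f => ∫ x, (f : G →ᵇ ℂ) x ∂(μ : Measure G)
      map_add' := fun f g => by
        simpa using integral_add ((f : G →ᵇ ℂ).integrable (μ : Measure G))
          ((g : G →ᵇ ℂ).integrable (μ : Measure G))
      map_smul' := fun c f => by
        simpa using integral_const_mul (μ := (μ : Measure G)) c (fun x => (f : G →ᵇ ℂ) x) }
    1 (fun f => by
      simpa using (f : G →ᵇ ℂ).norm_integral_le_norm (μ : Measure G))

/-- The map `I_G : Prob(G) → M(G)`, sending `μ` to the mean `f ↦ ∫ f dμ`. -/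
def toMean (μ : ProbabilityMeasure G) : Means G :=
  ⟨integralFunctional μ, by
    refine ⟨fun f hf => ?_, ?_⟩
    · change 0 ≤ ∫ x, (f : G →ᵇ ℂ) x ∂(μ : Measure G)
      exact integral_nonneg hf
    · change ∫ x, ((1 : RUCB G) : G →ᵇ ℂ) x ∂(μ : Measure G) = 1
      simp⟩

theorem toMean_apply (μ : ProbabilityMeasure G) (f : RUCB G) :
    (toMean μ).1 f = ∫ x, (f : G →ᵇ ℂ) x ∂(μ : Measure G) := rfl

/-- Convolution of Borel probability measures: the image of `μ ⊗ ν` under multiplication. -/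
def conv [SecondCountableTopology G] (μ ν : ProbabilityMeasure G) : ProbabilityMeasure G :=
  ⟨Measure.mconv (μ : Measure G) (ν : Measure G), inferInstance⟩

/-- Convolution powers of a Borel probability measure, with `μ ^ 0` the Dirac measure at `1`. -/
def convPow [SecondCountableTopology G] (μ : ProbabilityMeasure G) : ℕ → ProbabilityMeasure G
  | 0 => ⟨Measure.dirac 1, inferInstance⟩
  | n + 1 => conv (convPow μ n) μ

end Measure

end

end TopGroupAmenability

end

/-! The hard direction builds `μ` from an invariant mean by a random walk argument in the style of
Kaimanovich and Vershik. The topology is induced by a group seminorm `l`, and every UEB set is, up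
to a small error, contained in multiples of `lipBall l` after splitting into real and imaginary
parts. This ball is stable under right translations, hence under the averaging operator of `μ`,
whose `n`-th power at `g` integrates `f (g * x)` against `μ ^ n`. It remains to bring the values of
these powers at `g` and `1` together, uniformly on the ball.

Hahn-Banach turns the invariant mean into finitely carried measures that are almost invariant
uniformly on the ball (`IsAmenable.exists_almost_invariant`). Let `μ` be a mixture of such `ν j`
with positive weights, each `ν j` almost invariant under long words in the points carrying its
predecessors. Among `n k` independent letters, it is unlikely that all come from the first `k`
components. Otherwise the first later letter meets a prefix under which it is almost invariant, and
the difference nearly vanishes (`abs_iterate_average_mixture_sub_le`). Letting `ν j` charge the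
`j`-th point of a dense sequence gives full support.

Conversely, a weak-* limit point of the convolution powers is an invariant mean. -/

noncomputable section

namespace TopGroupAmenability

/-! ### Group seminorms and the ball of bounded Lipschitz functions -/

section LipschitzBall

variable {G : Type*} [Group G]

/-- The group seminorm `l` induces the topology of `G` at the identity. -/
def InducesNhdsOne [TopologicalSpace G] (l : GroupSeminorm G) : Prop :=
  (𝓝 (1 : G)).HasBasis (fun ε : ℝ => 0 < ε) fun ε => {g | l g < ε}

variable (G) in
/-- The topology at the identity of a first-countable group is induced by a group seminorm. -/
theorem exists_inducesNhdsOne [TopologicalSpace G] [IsTopologicalGroup G]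
    [FirstCountableTopology G] : ∃ l : GroupSeminorm G, InducesNhdsOne l := by
  let : UniformSpace G := IsTopologicalGroup.rightUniformSpace G
  have hu : uniformity G = comap (fun x : G × G => x.1 * x.2⁻¹) (𝓝 1) :=
    have : IsRightUniformGroup G := ⟨rfl⟩
    uniformity_eq_comap_mul_inv_nhds_one_swapped G
  have : (uniformity G).IsCountablyGenerated := by rw [hu]; infer_instance
  let : PseudoMetricSpace G := UniformSpace.pseudoMetricSpace G
  have hbdd : ∀ g : G, BddAbove (Set.range fun z : G => min 1 (dist (g * z) z)) := fun g =>
    ⟨1, by rintro _ ⟨z, rfl⟩; exact min_le_left _ _⟩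
  have hle : ∀ g z : G, min 1 (dist (g * z) z) ≤ ⨆ z : G, min 1 (dist (g * z) z) := fun g z =>
    le_ciSup (hbdd g) z
  -- The supremum over `z` gives subadditivity although `dist` need not be right-invariant;
  -- truncating at `1` keeps it finite.
  let l : GroupSeminorm G :=
    { toFun := fun g => ⨆ z : G, min 1 (dist (g * z) z)
      map_one' := by simp
      mul_le' := fun g h => by
        refine ciSup_le fun z => ?_
        have h1 := hle g (h * z)
        have h2 := hle h z
        have h3 : dist (g * h * z) z ≤ dist (g * (h * z)) (h * z) + dist (h * z) z := by
          rw [mul_assoc]; exact dist_triangle _ _ _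
        have h4 : 0 ≤ dist (g * (h * z)) (h * z) := dist_nonneg
        have h5 : 0 ≤ dist (h * z) z := dist_nonneg
        rcases min_cases 1 (dist (g * (h * z)) (h * z)) with ⟨e, _⟩ | ⟨e, _⟩ <;>
        rcases min_cases 1 (dist (h * z) z) with ⟨e', _⟩ | ⟨e', _⟩ <;>
        rcases min_cases 1 (dist (g * h * z) z) with ⟨e'', _⟩ | ⟨e'', _⟩ <;> linarith
      inv' := by
        have key : ∀ g : G, (⨆ z : G, min 1 (dist (g⁻¹ * z) z)) ≤
            ⨆ z : G, min 1 (dist (g * z) z) := fun g => by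
          refine ciSup_le fun z => ?_
          have := hle g (g⁻¹ * z)
          rwa [mul_inv_cancel_left, dist_comm] at this
        intro g
        refine le_antisymm (key g) ?_
        simpa using key g⁻¹ }
  have hl : ∀ g, l g = ⨆ z : G, min 1 (dist (g * z) z) := fun g => rfl
  refine ⟨l, ⟨fun t => ⟨fun ht => ?_, ?_⟩⟩⟩
  · obtain ⟨ε, hε, hb⟩ := Metric.mem_nhds_iff.1 ht
    refine ⟨min 1 ε, by positivity, fun g hg => hb ?_⟩
    have h1 := (hle g 1).trans_lt hg
    rw [mul_one] at h1
    rw [Metric.mem_ball]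
    rcases min_lt_iff.1 h1 with h | h
    · exact absurd (h.trans_le (min_le_left _ _)) (lt_irrefl _)
    · exact h.trans_le (min_le_right _ _)
  · rintro ⟨ε, hε, hb⟩
    refine mem_of_superset ?_ hb
    -- Entourages of the right uniformity only see `(g * z) * z⁻¹ = g`, so the bound is uniform in
    -- `z`.
    have h1 : {p : G × G | dist p.1 p.2 < ε / 2} ∈ uniformity G :=
      Metric.dist_mem_uniformity (half_pos hε)
    rw [hu] at h1
    obtain ⟨U, hU, hUs⟩ := h1
    refine mem_of_superset hU fun g hg => ?_
    change l g < ε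
    rw [hl]
    refine (ciSup_le fun z => ?_).trans_lt (half_lt_self hε)
    have : (g * z, z) ∈ (fun x : G × G => x.1 * x.2⁻¹) ⁻¹' U := by simpa using hg
    have h2 : dist (g * z) z < ε / 2 := hUs this
    exact (min_le_right _ _).trans h2.le

/-- The real functions on `G` that are bounded by `1` and `1`-Lipschitz with respect to the
right-invariant pseudometric `(x, y) ↦ l (x * y⁻¹)`. -/
def lipBall (l : GroupSeminorm G) : Set (G → ℝ) :=
  {f | (∀ x, |f x| ≤ 1) ∧ ∀ x y, |f x - f y| ≤ l (x * y⁻¹)}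

/-- A uniformly continuous bounded real function is, up to `ε`, a multiple of a member of
`lipBall l`; the factor depends only on the bound and on the modulus of continuity. -/
theorem exists_lipBall_approx (l : GroupSeminorm G) {f : G → ℝ} {C ε δ : ℝ} (hδ : 0 < δ)
    (hε : 0 ≤ ε) (hC : ∀ x, |f x| ≤ C) (hf : ∀ x y, l (x * y⁻¹) < δ → |f x - f y| ≤ ε) :
    ∃ h ∈ lipBall l, ∀ x, |f x - (C + 2 * C / δ + 1) * h x| ≤ ε := by
  have hC0 : 0 ≤ C := (abs_nonneg _).trans (hC 1)
  -- At slope `k` the penalty beyond distance `δ` exceeds the oscillation `2 * C`, so the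
  -- `k`-Lipschitz lower envelope `φ` of `f` stays within `ε` of `f`.
  set k := 2 * C / δ with hk
  have hk0 : 0 ≤ k := by positivity
  have hkδ : k * δ = 2 * C := by rw [hk]; field_simp
  have hl0 : ∀ x, 0 ≤ l x := fun x => apply_nonneg l x
  let φ : G → ℝ := fun x => ⨅ y, (f y + k * l (x * y⁻¹))
  have hlow : ∀ x y, -C ≤ f y + k * l (x * y⁻¹) := fun x y => by
    have := neg_le_of_abs_le (hC y)
    have := mul_nonneg hk0 (hl0 (x * y⁻¹))
    linarith
  have hbdd : ∀ x, BddBelow (Set.range fun y => f y + k * l (x * y⁻¹)) := fun x =>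
    ⟨-C, by rintro _ ⟨y, rfl⟩; exact hlow x y⟩
  have hφf : ∀ x, φ x ≤ f x := fun x => by
    simpa using ciInf_le (hbdd x) x
  have hφC : ∀ x, |φ x| ≤ C := fun x =>
    abs_le.2 ⟨le_ciInf fun y => hlow x y, (hφf x).trans (le_of_abs_le (hC x))⟩
  have hfφ : ∀ x, f x - ε ≤ φ x := fun x => by
    refine le_ciInf fun y => ?_
    by_cases h : l (x * y⁻¹) < δ
    · have := le_of_abs_le (hf x y h)
      have := mul_nonneg hk0 (hl0 (x * y⁻¹))
      linarith
    · have h1 : k * δ ≤ k * l (x * y⁻¹) := mul_le_mul_of_nonneg_left (not_lt.1 h) hk0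
      have := le_of_abs_le (hC x)
      have := neg_le_of_abs_le (hC y)
      linarith
  have hLip : ∀ x y, φ x ≤ φ y + k * l (x * y⁻¹) := fun x y => by
    rw [← sub_le_iff_le_add]
    refine le_ciInf fun z => ?_
    have h1 : φ x ≤ f z + k * l (x * z⁻¹) := ciInf_le (hbdd x) z
    have h2 : l (x * z⁻¹) ≤ l (x * y⁻¹) + l (y * z⁻¹) := by
      simpa [mul_assoc] using map_mul_le_add l (x * y⁻¹) (y * z⁻¹)
    have h3 := mul_le_mul_of_nonneg_left h2 hk0
    linarith
  -- The factor dominates both the bound `C` and the slope `k`; the `1` keeps it positive when `C =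
  -- 0`.
  have hL : 0 < C + k + 1 := by positivity
  have hsymm : ∀ x y, l (y * x⁻¹) = l (x * y⁻¹) := fun x y => by
    rw [← map_inv_eq_map l (x * y⁻¹)]; simp
  refine ⟨fun x => (C + k + 1)⁻¹ * φ x, ⟨fun x => ?_, fun x y => ?_⟩, fun x => ?_⟩
  · rw [abs_mul, abs_of_pos (inv_pos.2 hL), inv_mul_le_iff₀ hL]
    linarith [hφC x]
  · have h1 : |φ x - φ y| ≤ k * l (x * y⁻¹) := by
      have h2 := hLip y x
      rw [hsymm] at h2
      exact abs_le.2 ⟨by linarith, by linarith [hLip x y]⟩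
    rw [← mul_sub, abs_mul, abs_of_pos (inv_pos.2 hL), inv_mul_le_iff₀ hL]
    nlinarith [hl0 (x * y⁻¹)]
  · rw [mul_inv_cancel_left₀ hL.ne']
    exact abs_le.2 ⟨by linarith [hφf x], by linarith [hfφ x]⟩

theorem continuous_of_mem_lipBall [TopologicalSpace G] [IsTopologicalGroup G]
    {l : GroupSeminorm G} (hl : InducesNhdsOne l) {f : G → ℝ} (hf : f ∈ lipBall l) :
    Continuous f := by
  rw [continuous_iff_continuousAt]
  intro y
  rw [ContinuousAt, Metric.tendsto_nhds]
  intro ε hε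
  have ht : Tendsto (fun x : G => x * y⁻¹) (𝓝 y) (𝓝 1) := by
    have : Continuous fun x : G => x * y⁻¹ := by fun_prop
    simpa using this.tendsto y
  filter_upwards [ht (hl.mem_of_mem hε)] with x hx
  exact (hf.2 x y).trans_lt hx

/-- `lipBall l` is invariant under right translations. -/
theorem mul_right_mem_lipBall {l : GroupSeminorm G} {f : G → ℝ} (hf : f ∈ lipBall l) (a : G) :
    (fun x => f (x * a)) ∈ lipBall l :=
  ⟨fun x => hf.1 _, fun x y => by simpa [mul_assoc] using hf.2 (x * a) (y * a)⟩

end LipschitzBall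

/-! ### Averaging operators and convolution powers -/

section Averaging

variable {G : Type*} [Group G] [MeasurableSpace G]

/-- The averaging operator `f ↦ (x ↦ ∫ f (x * y) dμ(y))`. -/
def average (μ : Measure G) (f : G → ℝ) (x : G) : ℝ := ∫ y, f (x * y) ∂μ

variable [TopologicalSpace G] [IsTopologicalGroup G] [BorelSpace G] {l : GroupSeminorm G}

theorem integrable_of_mem_lipBall (hl : InducesNhdsOne l) (μ : Measure G) [IsFiniteMeasure μ]
    {f : G → ℝ} (hf : f ∈ lipBall l) (x : G) : Integrable (fun y => f (x * y)) μ := by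
  have hc : Continuous fun y => f (x * y) := (continuous_of_mem_lipBall hl hf).comp (by fun_prop)
  exact Integrable.of_bound hc.measurable.aestronglyMeasurable 1
    (Eventually.of_forall fun y => hf.1 _)

/-- Right translates stay in the ball, and its bounds survive integration against a probability
measure. -/
theorem average_mem_lipBall (hl : InducesNhdsOne l) (μ : Measure G) [IsProbabilityMeasure μ]
    {f : G → ℝ} (hf : f ∈ lipBall l) : average μ f ∈ lipBall l := by
  refine ⟨fun x => ?_, fun x y => ?_⟩
  · simpa [average] using norm_integral_le_of_norm_le_const (μ := μ) (f := fun y => f (x * y)) (C := 1)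
      (Eventually.of_forall fun y => hf.1 _)
  · rw [average, average, ← integral_sub (integrable_of_mem_lipBall hl μ hf x)
      (integrable_of_mem_lipBall hl μ hf y)]
    simpa using norm_integral_le_of_norm_le_const (μ := μ)
      (f := fun z => f (x * z) - f (y * z)) (C := l (x * y⁻¹))
      (Eventually.of_forall fun z => (mul_right_mem_lipBall hf z).2 x y)

theorem iterate_average_mem_lipBall (hl : InducesNhdsOne l) (μ : Measure G)
    [IsProbabilityMeasure μ] (n : ℕ) {f : G → ℝ} (hf : f ∈ lipBall l) :
    (average μ)^[n] f ∈ lipBall l := by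
  induction n with
  | zero => exact hf
  | succ n ih => rw [Function.iterate_succ_apply']; exact average_mem_lipBall hl μ ih

/-- Translates of convolution powers act on functions as powers of the averaging operator. -/
theorem integral_convPow [SecondCountableTopology G] (hl : InducesNhdsOne l)
    (μ : ProbabilityMeasure G) (n : ℕ) {f : G → ℝ} (hf : f ∈ lipBall l) (g : G) :
    ∫ x, f (g * x) ∂(convPow μ n : Measure G) = (average (μ : Measure G))^[n] f g := by
  induction n generalizing f with
  | zero =>
    have hc : Continuous fun y => f (g * y) := (continuous_of_mem_lipBall hl hf).comp (by fun_prop)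
    change ∫ x, f (g * x) ∂(Measure.dirac 1) = f g
    rw [integral_dirac' _ _ hc.stronglyMeasurable, mul_one]
  | succ n ih =>
    change ∫ x, f (g * x) ∂(Measure.mconv (convPow μ n : Measure G) (μ : Measure G)) = _
    rw [integral_mconv (integrable_of_mem_lipBall hl _ hf g), Function.iterate_succ_apply,
      ← ih (average_mem_lipBall hl μ hf)]
    simp only [average, mul_assoc]

end Averaging

/-! ### Finitely carried measures and point evaluations -/

/-- The probability measures on `G` that are carried by a finite set. -/
def finiteProb (G : Type*) [MeasurableSpace G] : Set (Measure G) :=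
  {ν | IsProbabilityMeasure ν ∧ ∃ S : Finset G, ν (S : Set G)ᶜ = 0}

/-- Intersecting with the finite carrier loses no mass and leaves a compact set. -/
theorem innerRegular_of_mem_finiteProb {X : Type*} [TopologicalSpace X] [MeasurableSpace X]
    {ν : Measure X} (hν : ν ∈ finiteProb X) :
    ν.InnerRegular := by
  obtain ⟨-, S, hS⟩ := hν
  refine ⟨fun U hU r hr => ⟨U ∩ S, Set.inter_subset_left,
    (S.finite_toSet.inter_of_right U).isCompact, ?_⟩⟩
  rwa [measure_inter_conull hS]

section Evaluation

variable {G : Type*} [Group G] {l : GroupSeminorm G}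

/-- Evaluation at a point, as a bounded function on `lipBall l`. -/
def evalLipBall (l : GroupSeminorm G) (x : G) : lipBall l →ᵇ ℝ :=
  BoundedContinuousFunction.ofNormedAddCommGroup (fun f => f.1 x)
    ((continuous_apply x).comp continuous_subtype_val) 1 fun f => f.2.1 x

theorem norm_evalLipBall_sub_le (x y : G) :
    ‖evalLipBall l x - evalLipBall l y‖ ≤ l (x * y⁻¹) :=
  (BoundedContinuousFunction.norm_le (apply_nonneg l _)).2 fun f => f.2.2 x y

/-- The functions on `F × lipBall l` that measure the failure of invariance of a finitely
carried probability measure. -/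
def defectSet [MeasurableSpace G] (l : GroupSeminorm G) (F : Finset G) : Set (F → lipBall l →ᵇ ℝ) :=
  {v | ∃ ν ∈ finiteProb G, ∀ h f, v h f = ∫ x, f.1 (h * x) ∂ν - ∫ x, f.1 x ∂ν}

theorem evalLipBall_sub_mem_defectSet [MeasurableSpace G] [MeasurableSingletonClass G] (F : Finset G) (x : G) :
    (fun h : F => evalLipBall l (h * x) - evalLipBall l x) ∈ defectSet l F := by
  refine ⟨Measure.dirac x, ⟨inferInstance, {x}, by simp⟩, fun h f => ?_⟩
  simp [integral_dirac]
  rfl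

end Evaluation

/-! ### Almost invariant measures from an invariant mean -/

section AlmostInvariant

variable {G : Type*} [Group G] [TopologicalSpace G] [IsTopologicalGroup G] {l : GroupSeminorm G}

/-- Makes a functional composed with point evaluations accessible to the mean; its norm serves as
both the bound and the Lipschitz constant `C`. -/
theorem exists_RUCB_of_lipschitz (hl : InducesNhdsOne l) {v : G → ℝ} {C : ℝ}
    (hC : ∀ x, |v x| ≤ C) (hv : ∀ x y, |v x - v y| ≤ C * l (x * y⁻¹)) :
    ∃ f : RUCB G, ∀ x, (f : G →ᵇ ℂ) x = v x := by
  have hC0 : 0 ≤ C := (abs_nonneg _).trans (hC 1)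
  have hu : RightUniformContinuous fun x => (v x : ℂ) := fun ε hε => by
    refine ⟨{g | l g < ε / (C + 1)}, hl.mem_of_mem (by positivity), fun x y hxy => ?_⟩
    have h1 : l (x * y⁻¹) * (C + 1) < ε := (lt_div_iff₀ (by positivity)).1 hxy
    rw [← Complex.ofReal_sub, Complex.norm_real, Real.norm_eq_abs]
    nlinarith [hv x y, apply_nonneg l (x * y⁻¹)]
  exact ⟨⟨BoundedContinuousFunction.ofNormedAddCommGroup (fun x => (v x : ℂ)) hu.continuous C
    fun x => by simpa using hC x, hu⟩, fun x => rfl⟩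

/-- On an amenable group, a finite sum of coboundaries is not bounded away from zero. -/
theorem IsAmenable.exists_sum_translate_sub_le (hG : IsAmenable G) {ι : Type*} (s : Finset ι)
    (g : ι → G) (f : ι → RUCB G) (v : ι → G → ℝ) (hv : ∀ i x, (f i : G →ᵇ ℂ) x = v i x)
    {c : ℝ} (hc : 0 < c) : ∃ x, ∑ i ∈ s, (v i (g i * x) - v i x) < c := by
  obtain ⟨m, ⟨hpos, hone⟩, hinv⟩ := hG
  by_contra! h
  -- The mean kills each coboundary, so positivity of the sum minus `c` would give `0 ≤ -c`.
  have h1 := hpos (∑ i ∈ s, (leftTranslate (g i) (f i) - f i) - (c : ℂ) • 1) fun x => by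
    have : ((∑ i ∈ s, (leftTranslate (g i) (f i) - f i) - (c : ℂ) • 1 : RUCB G) : G →ᵇ ℂ) x
        = ((∑ i ∈ s, (v i (g i * x) - v i x) - c : ℝ) : ℂ) := by
      simp [hv]
    rw [this]
    exact_mod_cast sub_nonneg.2 (h x)
  have h2 : m (∑ i ∈ s, (leftTranslate (g i) (f i) - f i) - (c : ℂ) • 1) = ((-c : ℝ) : ℂ) := by
    simp [map_sum, hinv, hone]
  rw [h2] at h1
  have : (0 : ℝ) ≤ -c := by exact_mod_cast h1
  linarith

variable [MeasurableSpace G] [BorelSpace G]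

theorem convex_defectSet (hl : InducesNhdsOne l) (F : Finset G) : Convex ℝ (defectSet l F) := by
  classical
  rintro v ⟨ν, ⟨hν, S, hS⟩, hv⟩ w ⟨ρ, ⟨hρ, T, hT⟩, hw⟩ a b ha hb hab
  have hint : ∀ (f : lipBall l) (g : G) (σ : Measure G) [IsProbabilityMeasure σ] (c : ℝ),
      Integrable (fun x => f.1 (g * x)) (ENNReal.ofReal c • σ) := fun f g σ _ c =>
    (integrable_of_mem_lipBall hl σ f.2 g).smul_measure ENNReal.ofReal_ne_top
  have hval : ∀ (f : lipBall l) (g : G),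
      ∫ x, f.1 (g * x) ∂(ENNReal.ofReal a • ν + ENNReal.ofReal b • ρ) =
        a * ∫ x, f.1 (g * x) ∂ν + b * ∫ x, f.1 (g * x) ∂ρ := fun f g => by
    rw [integral_add_measure (hint f g ν a) (hint f g ρ b), integral_smul_measure,
      integral_smul_measure, ENNReal.toReal_ofReal ha, ENNReal.toReal_ofReal hb]
    rfl
  refine ⟨ENNReal.ofReal a • ν + ENNReal.ofReal b • ρ, ⟨⟨?_⟩, S ∪ T, ?_⟩, fun h f => ?_⟩
  · simp [← ENNReal.ofReal_add ha hb, hab]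
  · have h1 : ν ((S ∪ T : Finset G) : Set G)ᶜ = 0 := measure_mono_null (by
      rw [Finset.coe_union]; exact Set.compl_subset_compl.2 Set.subset_union_left) hS
    have h2 : ρ ((S ∪ T : Finset G) : Set G)ᶜ = 0 := measure_mono_null (by
      rw [Finset.coe_union]; exact Set.compl_subset_compl.2 Set.subset_union_right) hT
    simp [Measure.add_apply, Measure.smul_apply, h1, h2, -Finset.coe_union]
  · have h1 := hval f 1
    simp only [one_mul] at h1
    rw [hval, h1]
    simp only [Pi.add_apply, Pi.smul_apply, BoundedContinuousFunction.coe_add,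
      BoundedContinuousFunction.coe_smul, hv, hw, smul_eq_mul]
    ring

/-- Over an amenable group, finitely carried probability measures approximate invariance
uniformly on `lipBall l`. -/
theorem IsAmenable.exists_almost_invariant [T1Space G] (hl : InducesNhdsOne l)
    (hG : IsAmenable G) (F : Finset G) {ε : ℝ} (hε : 0 < ε) :
    ∃ ν ∈ finiteProb G, ∀ f ∈ lipBall l, ∀ h ∈ F,
      |∫ x, f (h * x) ∂ν - ∫ x, f x ∂ν| ≤ ε := by
  classical
  have h0 : (0 : F → lipBall l →ᵇ ℝ) ∈ closure (defectSet l F) := by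
    by_contra hcl
    -- A separating `Φ` exceeds `c > 0` on all defects. On those of Dirac masses its value is a sum
    -- of coboundaries of the functions `v h`, which cannot stay above `c` everywhere.
    obtain ⟨Φ, c, hc0, hc⟩ := geometric_hahn_banach_point_closed
      (convex_defectSet hl F).closure isClosed_closure hcl
    rw [map_zero] at hc0
    let v : F → G → ℝ := fun h y => Φ (Pi.single h (evalLipBall l y))
    have hb : ∀ (h : F) (w : lipBall l →ᵇ ℝ), |Φ (Pi.single h w)| ≤ ‖Φ‖ * ‖w‖ := fun h w => by
      exact (Φ.le_opNorm _).trans_eq (congrArg (‖Φ‖ * ·)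
        (Pi.norm_single (G := fun _ : F => lipBall l →ᵇ ℝ) w))
    have hf : ∀ h, ∃ f : RUCB G, ∀ x, (f : G →ᵇ ℂ) x = v h x := fun h => by
      refine exists_RUCB_of_lipschitz hl (C := ‖Φ‖) (fun x => ?_) fun x y => ?_
      · refine (hb h _).trans (mul_le_of_le_one_right Φ.opNorm_nonneg ?_)
        exact BoundedContinuousFunction.norm_ofNormedAddCommGroup_le _ zero_le_one _
      · have : v h x - v h y = Φ (Pi.single h (evalLipBall l x - evalLipBall l y)) := by
          rw [Pi.single_sub, map_sub]
        rw [this]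
        exact (hb h _).trans
          (mul_le_mul_of_nonneg_left (norm_evalLipBall_sub_le x y) Φ.opNorm_nonneg)
    choose f hf using hf
    obtain ⟨x, hx⟩ := hG.exists_sum_translate_sub_le Finset.univ (fun h : F => (h : G)) f v hf hc0
    refine (hc _ (subset_closure (evalLipBall_sub_mem_defectSet F x))).not_ge (le_of_eq ?_ |>.trans
      hx.le)
    rw [← Finset.univ_sum_single (fun h : F => evalLipBall l (h * x) - evalLipBall l x), map_sum]
    refine Finset.sum_congr rfl fun h _ => ?_
    rw [Pi.single_sub, map_sub]
  obtain ⟨w, ⟨ν, hν, hw⟩, hwε⟩ := Metric.mem_closure_iff.1 h0 ε hε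
  refine ⟨ν, hν, fun f hf h hh => ?_⟩
  rw [dist_zero_left] at hwε
  rw [← hw ⟨h, hh⟩ ⟨f, hf⟩]
  exact ((w ⟨h, hh⟩).norm_coe_le_norm ⟨f, hf⟩).trans ((norm_le_pi_norm w _).trans hwε.le)

/-- The almost invariant measures can be chosen to charge a given point. -/
theorem IsAmenable.exists_almost_invariant_charging [T1Space G] (hl : InducesNhdsOne l)
    (hG : IsAmenable G) (F : Finset G) {ε : ℝ} (hε : 0 < ε) (a : G) :
    ∃ ν ∈ finiteProb G, ν {a} ≠ 0 ∧ ∀ f ∈ lipBall l, ∀ h ∈ F,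
      |average ν f h - average ν f 1| ≤ ε := by
  classical
  obtain ⟨ν, ⟨hν, S, hS⟩, hinv⟩ := hG.exists_almost_invariant hl F hε
  obtain ⟨s, hs⟩ : ∃ s, ν {s} ≠ 0 := by
    by_contra! h
    have h1 : ν (S : Set G) = 0 := by
      rw [← Set.biUnion_of_singleton (S : Set G)]
      exact (measure_biUnion_null_iff S.countable_toSet).2 fun x _ => h x
    have h2 : ν Set.univ = 0 := by
      rw [← Set.union_compl_self (S : Set G)]
      exact measure_union_null h1 hS
    simp at h2
  -- A right translation moves the atom `s` to `a`; it commutes with left translations and preserves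
  -- the ball, so almost invariance is kept.
  have hm : Measurable fun x : G => x * (s⁻¹ * a) :=
    (by fun_prop : Continuous fun x : G => x * (s⁻¹ * a)).measurable
  refine ⟨ν.map fun x => x * (s⁻¹ * a), ⟨Measure.isProbabilityMeasure_map hm.aemeasurable,
    S.image fun x => x * (s⁻¹ * a), ?_⟩, ?_, fun f hf h hh => ?_⟩
  · rw [Measure.map_apply hm (Finset.measurableSet _).compl]
    refine measure_mono_null (Set.compl_subset_compl.2 fun x hxS => ?_) hS
    exact Finset.mem_coe.2 (Finset.mem_image_of_mem _ (Finset.mem_coe.1 hxS))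
  · rw [Measure.map_apply hm (measurableSet_singleton a)]
    refine fun h => hs (measure_mono_null ?_ h)
    rintro x rfl
    simp
  · have hmap : ∀ g, average (ν.map fun x => x * (s⁻¹ * a)) f g =
        ∫ x, f (g * x * (s⁻¹ * a)) ∂ν := fun g => by
      have hc : Continuous fun y => f (g * y) :=
        (continuous_of_mem_lipBall hl hf).comp (by fun_prop)
      rw [average, integral_map hm.aemeasurable hc.measurable.aestronglyMeasurable]
      simp only [mul_assoc]
    rw [hmap, hmap]
    simpa using hinv _ (mul_right_mem_lipBall hf (s⁻¹ * a)) h hh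

end AlmostInvariant

/-! ### The mixture and the decay of differences -/

section Mixture

open scoped Pointwise

/-- The mixture of the measures `ν j` with weights `w j`. -/
def mixture {X : Type*} [MeasurableSpace X] (w : ℕ → ℝ) (ν : ℕ → Measure X) : Measure X :=
  Measure.sum fun j => ENNReal.ofReal (w j) • ν j

theorem isProbabilityMeasure_mixture {X : Type*} [MeasurableSpace X] {w : ℕ → ℝ}
    (hw0 : ∀ j, 0 ≤ w j) (hw : HasSum w 1) (ν : ℕ → Measure X)
    [∀ j, IsProbabilityMeasure (ν j)] : IsProbabilityMeasure (mixture w ν) := by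
  refine ⟨?_⟩
  rw [mixture, Measure.sum_apply _ MeasurableSet.univ]
  simp only [Measure.smul_apply, measure_univ, smul_eq_mul, mul_one]
  rw [← ENNReal.ofReal_tsum_of_nonneg hw0 hw.summable, hw.tsum_eq, ENNReal.ofReal_one]

variable {G : Type*} [Group G] [TopologicalSpace G] [IsTopologicalGroup G] [MeasurableSpace G]
  [BorelSpace G] {l : GroupSeminorm G}

theorem hasSum_average_mixture (hl : InducesNhdsOne l) {w : ℕ → ℝ} (hw0 : ∀ j, 0 ≤ w j)
    (hw : HasSum w 1) (ν : ℕ → Measure G) [∀ j, IsProbabilityMeasure (ν j)] {f : G → ℝ}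
    (hf : f ∈ lipBall l) (x : G) :
    HasSum (fun j => w j * average (ν j) f x) (average (mixture w ν) f x) := by
  have := isProbabilityMeasure_mixture hw0 hw ν
  have h := hasSum_integral_measure (integrable_of_mem_lipBall hl (mixture w ν) hf x)
  simp only [integral_smul_measure, ENNReal.toReal_ofReal (hw0 _), smul_eq_mul] at h
  exact h

/-- If the first `k` components of a mixture are carried by `T` and the others are almost
invariant under `F`, then the powers of the averaging operator bring the values at two points
together for as long as the products with words in `T` stay in `F`. -/
theorem abs_iterate_average_mixture_sub_le (hl : InducesNhdsOne l) {w : ℕ → ℝ}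
    (hw0 : ∀ j, 0 ≤ w j) (hw : HasSum w 1) (ν : ℕ → Measure G) [∀ j, IsProbabilityMeasure (ν j)]
    {k : ℕ} {T F : Set G} {ε : ℝ} (hε : 0 ≤ ε) (hT : ∀ j < k, ν j Tᶜ = 0)
    (hF : ∀ j, k ≤ j → ∀ f ∈ lipBall l, ∀ h ∈ F, |average (ν j) f h - average (ν j) f 1| ≤ ε)
    (n : ℕ) (x y : G) (hxy : ∀ i < n, ∀ t ∈ T ^ i, x * t ∈ F ∧ y * t ∈ F) {f : G → ℝ}
    (hf : f ∈ lipBall l) :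
    |(average (mixture w ν))^[n] f x - (average (mixture w ν))^[n] f y| ≤
      2 * (∑ j ∈ Finset.range k, w j) ^ n + 2 * ε := by
  induction n generalizing x y with
  | zero =>
    have h1 := abs_le.1 (hf.1 x)
    have h2 := abs_le.1 (hf.1 y)
    simp only [Function.iterate_zero, id_eq, pow_zero]
    exact abs_le.2 ⟨by linarith, by linarith⟩
  | succ n ih =>
    have := isProbabilityMeasure_mixture hw0 hw ν
    set a := ∑ j ∈ Finset.range k, w j with ha
    have ha0 : 0 ≤ a := Finset.sum_nonneg fun j _ => hw0 j
    set φ := (average (mixture w ν))^[n] f with hφ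
    have hφH : φ ∈ lipBall l := iterate_average_mem_lipBall hl _ n hf
    rw [Function.iterate_succ_apply', ← hφ]
    -- A component below `k` appends a letter of `T` and continues the induction. Any other one
    -- compares both points with `1` at cost `2 * ε`, whatever the later letters do, since `φ` is in
    -- the ball. Hence `ε` does not accumulate.
    have hterm : ∀ j, |average (ν j) φ x - average (ν j) φ y| ≤
        2 * ε + if j ∈ Finset.range k then 2 * a ^ n else 0 := fun j => by
      split_ifs with hj
      · rw [average, average, ← integral_sub (integrable_of_mem_lipBall hl _ hφH x)
          (integrable_of_mem_lipBall hl _ hφH y)]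
        have hae : ∀ᵐ s ∂(ν j), ‖φ (x * s) - φ (y * s)‖ ≤ 2 * a ^ n + 2 * ε := by
          have hTj : ∀ᵐ s ∂(ν j), s ∈ T := hT j (Finset.mem_range.1 hj)
          filter_upwards [hTj] with s hs
          refine ih (x * s) (y * s) fun i hi t ht => ?_
          simpa [mul_assoc] using hxy (i + 1) (by omega) (s * t)
            (by rw [pow_succ']; exact Set.mul_mem_mul hs ht)
        simpa [add_comm] using norm_integral_le_of_norm_le_const hae
      · have h0 := hxy 0 n.succ_pos 1 (by simp)
        simp only [mul_one] at h0
        have hj' : k ≤ j := by simpa using hj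
        have h1 := abs_le.1 (hF j hj' φ hφH x h0.1)
        have h2 := abs_le.1 (hF j hj' φ hφH y h0.2)
        exact abs_le.2 ⟨by linarith, by linarith⟩
    have hs1 := (hasSum_average_mixture hl hw0 hw ν hφH x).sub
      (hasSum_average_mixture hl hw0 hw ν hφH y)
    have hs2 : HasSum (fun j => w j * (2 * ε + if j ∈ Finset.range k then 2 * a ^ n else 0))
        (2 * ε + a * (2 * a ^ n)) := by
      have h1 : HasSum (fun j => w j * (if j ∈ Finset.range k then 2 * a ^ n else 0))
          (a * (2 * a ^ n)) := by
        have h2 : a * (2 * a ^ n) = ∑ j ∈ Finset.range k,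
            w j * (if j ∈ Finset.range k then 2 * a ^ n else 0) := by
          rw [ha, Finset.sum_mul]
          exact Finset.sum_congr rfl fun j hj => by rw [if_pos hj]
        rw [h2]
        exact hasSum_sum_of_ne_finset_zero fun j hj => by rw [if_neg hj, mul_zero]
      simpa [mul_add] using (hw.mul_right (2 * ε)).add h1
    have hb : ∀ j, |w j * average (ν j) φ x - w j * average (ν j) φ y| ≤
        w j * (2 * ε + if j ∈ Finset.range k then 2 * a ^ n else 0) := fun j => by
      rw [← mul_sub, abs_mul, abs_of_nonneg (hw0 j)]
      exact mul_le_mul_of_nonneg_left (hterm j) (hw0 j)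
    have h1 := hasSum_le (fun j => (abs_le.1 (hb j)).2) hs1 hs2
    have h2 := hasSum_le (fun j => (abs_le.1 (hb j)).1) hs2.neg hs1
    have h3 : 2 * a ^ (n + 1) + 2 * ε = 2 * ε + a * (2 * a ^ n) := by ring
    rw [h3]
    exact abs_le.2 ⟨h2, h1⟩

/-- A sequence of finitely carried measures, each almost invariant under long words in the points
that carry the preceding ones. -/
theorem IsAmenable.exists_almost_invariant_seq [T1Space G] (hl : InducesNhdsOne l)
    (hG : IsAmenable G) (n : ℕ → ℕ) (d : ℕ → G) :
    ∃ ν : ℕ → Measure G, (∀ j, ν j ∈ finiteProb G) ∧ (∀ j, ν j {d j} ≠ 0) ∧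
      ∀ k, ∃ T F : Set G, (∀ j < k, ν j Tᶜ = 0) ∧
        (∀ j, k ≤ j → ∀ f ∈ lipBall l, ∀ h ∈ F,
          |average (ν j) f h - average (ν j) f 1| ≤ 1 / ((k : ℝ) + 1)) ∧
        ∀ i < n k, ∀ t ∈ T ^ i, t ∈ F ∧ ∀ m ≤ k, d m * t ∈ F := by
  classical
  choose ρ hρ hρd hρF using fun (k : ℕ) (F : Finset G) =>
    hG.exists_almost_invariant_charging hl F (ε := 1 / ((k : ℝ) + 1)) (by positivity) (d k)
  choose S hS using fun k F => (hρ k F).2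
  -- `T k` contains the points carrying the measures before stage `k`, and `Φ k (T k)` the words
  -- under which the `k`-th must be almost invariant. Each contains the preceding set, so later
  -- measures are almost invariant under it too.
  let Φ : ℕ → Finset G → Finset G := fun k T =>
    T ∪ (Finset.range (n k)).biUnion fun i => insert 1 ((Finset.range (k + 1)).image d) * T ^ i
  obtain ⟨T, hTsucc⟩ : ∃ T : ℕ → Finset G, ∀ k, T (k + 1) = Φ k (T k) ∪ S k (Φ k (T k)) :=
    ⟨fun k => Nat.rec ∅ (fun k T => Φ k T ∪ S k (Φ k T)) k, fun k => rfl⟩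
  have hTΦ : ∀ k, T k ⊆ Φ k (T k) := fun k => Finset.subset_union_left
  have hΦT : ∀ k, Φ k (T k) ⊆ T (k + 1) := fun k => hTsucc k ▸ Finset.subset_union_left
  have hTmono : Monotone T := monotone_nat_of_le_succ fun k => (hTΦ k).trans (hΦT k)
  have hΦmono : Monotone fun k => Φ k (T k) :=
    monotone_nat_of_le_succ fun k => (hΦT k).trans (hTΦ (k + 1))
  refine ⟨fun j => ρ j (Φ j (T j)), fun j => hρ _ _, fun j => hρd _ _, fun k =>
    ⟨(T k : Set G), (Φ k (T k) : Set G), fun j hj => ?_, fun j hj f hf h hh => ?_, fun i hi t ht => ?_⟩⟩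
  · refine measure_mono_null (Set.compl_subset_compl.2 ?_) (hS j (Φ j (T j)))
    exact Finset.coe_subset.2 ((hTsucc j ▸ Finset.subset_union_right).trans (hTmono hj))
  · refine (hρF j _ f hf h (hΦmono hj hh)).trans ?_
    gcongr
  · have key : ∀ g ∈ insert 1 ((Finset.range (k + 1)).image d), g * t ∈ Φ k (T k) :=
      fun g hg => Finset.mem_union_right _ (Finset.mem_biUnion.2 ⟨i, Finset.mem_range.2 hi,
        Finset.mul_mem_mul hg (by rwa [← Finset.coe_pow, Finset.mem_coe] at ht)⟩)
    refine ⟨?_, fun m hm => ?_⟩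
    · simpa using key 1 (Finset.mem_insert_self _ _)
    · exact key _ (Finset.mem_insert_of_mem
        (Finset.mem_image_of_mem d (Finset.mem_range.2 (by omega))))

/-- An amenable second-countable group carries a fully supported regular probability measure whose
convolution powers converge to invariance uniformly on `lipBall l`. -/
theorem IsAmenable.exists_measure [T1Space G] [SecondCountableTopology G]
    (hl : InducesNhdsOne l) (hG : IsAmenable G) :
    ∃ μ : ProbabilityMeasure G, (μ : Measure G).support = Set.univ ∧
      (μ : Measure G).InnerRegular ∧ ∀ (g : G) (ε : ℝ), 0 < ε → ∃ N, ∀ n, N ≤ n →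
        ∀ f ∈ lipBall l,
          |(average (μ : Measure G))^[n] f g - (average (μ : Measure G))^[n] f 1| ≤ ε := by
  let w : ℕ → ℝ := fun j => 1 / 2 / 2 ^ j
  have hwpos : ∀ j, 0 < w j := fun j => by positivity
  have hw0 : ∀ j, 0 ≤ w j := fun j => (hwpos j).le
  have hw : HasSum w 1 := hasSum_geometric_two' 1
  have hlt : ∀ k, ∑ j ∈ Finset.range k, w j < 1 := fun k => by
    have h1 := sum_le_hasSum (Finset.range (k + 1)) (fun j _ => hw0 j) hw
    rw [Finset.sum_range_succ] at h1
    linarith [hwpos k]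
  -- The chance that `n k` letters all come from the first `k` components is below `1 / (k + 1)`.
  choose n hn using fun k : ℕ => exists_pow_lt_of_lt_one
    (show (0 : ℝ) < 1 / ((k : ℝ) + 1) by positivity) (hlt k)
  obtain ⟨ν, hν, hνd, hνF⟩ := hG.exists_almost_invariant_seq hl n (TopologicalSpace.denseSeq G)
  have (j : ℕ) : IsProbabilityMeasure (ν j) := (hν j).1
  have (j : ℕ) : (ν j).InnerRegular := innerRegular_of_mem_finiteProb (hν j)
  have hprob := isProbabilityMeasure_mixture hw0 hw ν
  refine ⟨⟨mixture w ν, hprob⟩, ?_, ?_, fun g ε hε => ?_⟩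
  · refine Set.eq_univ_of_forall fun x => (Measure.mem_support_iff_forall x).2 fun U hU => ?_
    obtain ⟨j, hj⟩ := (TopologicalSpace.denseRange_denseSeq G).exists_mem_open isOpen_interior
      ⟨x, mem_interior_iff_mem_nhds.2 hU⟩
    have h1 : 0 < ENNReal.ofReal (w j) * ν j {TopologicalSpace.denseSeq G j} :=
      ENNReal.mul_pos (ENNReal.ofReal_pos.2 (hwpos j)).ne' (hνd j)
    refine h1.trans_le ?_
    calc ENNReal.ofReal (w j) * ν j {TopologicalSpace.denseSeq G j}
        ≤ ENNReal.ofReal (w j) * ν j U := by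
          gcongr
          exact Set.singleton_subset_iff.2 (interior_subset hj)
      _ = (ENNReal.ofReal (w j) • ν j) U := by simp
      _ ≤ mixture w ν U := Measure.le_sum (fun j => ENNReal.ofReal (w j) • ν j) j U
  · change (Measure.sum fun j => ENNReal.ofReal (w j) • ν j).InnerRegular
    infer_instance
  · change ∃ N, ∀ n, N ≤ n → ∀ f ∈ lipBall l,
      |(average (mixture w ν))^[n] f g - (average (mixture w ν))^[n] f 1| ≤ ε
    -- Only the dense points enter the words, so `g` is replaced by one of them; the Lipschitz bound
    -- makes this cost at most `ε / 2`.
    have hden : {y : G | l (g * y⁻¹) < ε / 2} ∈ 𝓝 g := by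
      have ht : Tendsto (fun y : G => g * y⁻¹) (𝓝 g) (𝓝 1) := by
        have : Continuous fun y : G => g * y⁻¹ := by fun_prop
        simpa using this.tendsto g
      exact ht (hl.mem_of_mem (half_pos hε))
    obtain ⟨m, hm⟩ := (TopologicalSpace.denseRange_denseSeq G).exists_mem_open isOpen_interior
      ⟨g, mem_interior_iff_mem_nhds.2 hden⟩
    replace hm : TopologicalSpace.denseSeq G m ∈ {y : G | l (g * y⁻¹) < ε / 2} :=
      interior_subset hm
    rw [Set.mem_ofPred_eq] at hm
    -- The decay estimate gives at most `4 / (k + 1)`, to be at most `ε / 2`; `k ≥ m` admits the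
    -- chosen dense point.
    obtain ⟨k₀, hk₀⟩ := exists_nat_gt (8 / ε)
    set k := max m k₀
    have hk : 4 * (1 / ((k : ℝ) + 1)) ≤ ε / 2 := by
      have h1 : 8 / ε < (k : ℝ) + 1 := by
        have : (k₀ : ℝ) ≤ k := by exact_mod_cast le_max_right m k₀
        linarith
      rw [div_lt_iff₀ hε] at h1
      rw [mul_one_div, div_le_iff₀ (by positivity)]
      linarith
    obtain ⟨T, F, hT, hF, hword⟩ := hνF k
    refine ⟨n k, fun N hN f hf => ?_⟩
    obtain ⟨r, rfl⟩ := Nat.exists_eq_add_of_le hN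
    -- The inner `r` averages stay in the ball, so the estimate for `n k` steps covers all later
    -- times.
    rw [Function.iterate_add_apply]
    have hr := iterate_average_mem_lipBall hl (mixture w ν) r hf
    have h1 := abs_iterate_average_mixture_sub_le hl hw0 hw ν (by positivity) hT hF (n k)
      (TopologicalSpace.denseSeq G m) 1 (fun i hi t ht =>
        ⟨(hword i hi t ht).2 m (le_max_left _ _), by simpa using (hword i hi t ht).1⟩) hr
    have h2 := (iterate_average_mem_lipBall hl (mixture w ν) (n k) hr).2 g
      (TopologicalSpace.denseSeq G m)
    refine (abs_sub_le _ _ _).trans ((add_le_add h2 h1).trans ?_)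
    linarith [hn k]

end Mixture

/-! ### From convergence to an invariant mean, and from the ball to UEB sets -/

section Convergence

variable {G : Type*} [Group G] [TopologicalSpace G] [IsTopologicalGroup G]
  [MeasurableSpace G] [BorelSpace G]

/-- A group that carries a sequence of probability measures UEB-converging to invariance is
amenable. -/
theorem isAmenable_of_uebConvergesToInvariance (μ : ℕ → ProbabilityMeasure G)
    (hμ : UEBConvergesToInvariance atTop fun n : ℕ => toMean (μ n)) : IsAmenable G := by
  -- The dual unit ball is weak-* compact but need not be sequentially compact, hence a limit along
  -- an ultrafilter.
  let U : Ultrafilter ℕ := hyperfilter ℕ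
  let m : ℕ → WeakDual ℂ (RUCB G) := fun n => StrongDual.toWeakDual (toMean (μ n)).1
  have hm : ∀ n, m n ∈ WeakDual.toStrongDual ⁻¹' Metric.closedBall (0 : StrongDual ℂ (RUCB G)) 1 :=
    fun n => by
      change (toMean (μ n)).1 ∈ Metric.closedBall (0 : StrongDual ℂ (RUCB G)) 1
      refine (mem_closedBall_zero_iff (E := StrongDual ℂ (RUCB G))).2 ?_
      refine ContinuousLinearMap.opNorm_le_bound _ zero_le_one fun f => ?_
      rw [one_mul, toMean_apply]
      exact (f : G →ᵇ ℂ).norm_integral_le_norm _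
  obtain ⟨φ, -, hφ⟩ := (WeakDual.isCompact_closedBall
    (0 : StrongDual ℂ (RUCB G)) 1).ultrafilter_le_nhds (U.map m) (le_principal_iff.2 (Ultrafilter.mem_map.2 (univ_mem' hm)))
  have hlim : ∀ f : RUCB G, Tendsto (fun n => (toMean (μ n)).1 f) U (𝓝 (φ f)) := fun f =>
    ((WeakDual.eval_continuous f).tendsto φ).comp hφ
  have hU : (U : Filter ℕ) ≤ atTop := Nat.hyperfilter_le_atTop
  refine ⟨WeakDual.toStrongDual φ, ⟨fun f hf => ?_, ?_⟩, fun g f => ?_⟩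
  · exact ge_of_tendsto (hlim f) (Eventually.of_forall fun n => (toMean (μ n)).2.1 f hf)
  · refine tendsto_nhds_unique (hlim 1) ?_
    simp only [(toMean (μ _)).2.2]
    exact tendsto_const_nhds
  · have hueb : IsUEB {f} := by
      refine ⟨⟨‖f‖, fun h hh => by rw [Set.mem_singleton_iff.1 hh]⟩, fun ε hε => ?_⟩
      obtain ⟨V, hV, hfV⟩ := f.2 ε hε
      exact ⟨V, hV, by rintro _ ⟨h, rfl, rfl⟩; exact hfV⟩
    have h1 := (hμ g {f} hueb).mono_left hU
    simp only [Set.mem_singleton_iff, iSup_iSup_eq_left] at h1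
    have h2 := tendsto_zero_iff_enorm_tendsto_zero.2 h1
    have h3 := (hlim (leftTranslate g f)).sub (hlim f)
    exact sub_eq_zero.1 (tendsto_nhds_unique h3 h2)

variable [SecondCountableTopology G] {l : GroupSeminorm G}

/-- Uniform convergence to invariance on `lipBall l` passes to uniformly bounded and uniformly
equicontinuous families of real functions. -/
theorem exists_forall_abs_integral_convPow_sub_le (hl : InducesNhdsOne l)
    (μ : ProbabilityMeasure G) (g : G)
    (hμ : ∀ ε : ℝ, 0 < ε → ∃ N, ∀ n, N ≤ n → ∀ f ∈ lipBall l,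
      |(average (μ : Measure G))^[n] f g - (average (μ : Measure G))^[n] f 1| ≤ ε)
    {C ε δ : ℝ} (hC : 0 ≤ C) (hε : 0 < ε) (hδ : 0 < δ) :
    ∃ N, ∀ n, N ≤ n → ∀ f : G → ℝ, Continuous f → (∀ x, |f x| ≤ C) →
      (∀ x y, l (x * y⁻¹) < δ → |f x - f y| ≤ ε) →
      |∫ x, f (g * x) ∂(convPow μ n : Measure G) - ∫ x, f x ∂(convPow μ n : Measure G)|
        ≤ 3 * ε := by
  set L := C + 2 * C / δ + 1 with hL
  have hL0 : 0 < L := by positivity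
  -- Rescaling by `L` costs `ε`, and so does the approximation at each of `g` and `1`: in all `3 *
  -- ε`.
  obtain ⟨N, hN⟩ := hμ (ε / L) (by positivity)
  refine ⟨N, fun n hn f hfc hfC hfδ => ?_⟩
  obtain ⟨h, hh, hfh⟩ := exists_lipBall_approx l hδ hε.le hfC hfδ
  rw [← hL] at hfh
  have happrox : ∀ a : G, |∫ x, f (a * x) ∂(convPow μ n : Measure G) -
      L * (average (μ : Measure G))^[n] h a| ≤ ε := fun a => by
    have hca : Continuous fun x => f (a * x) := hfc.comp (by fun_prop)
    have hi : Integrable (fun x => f (a * x)) (convPow μ n : Measure G) :=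
      Integrable.of_bound hca.measurable.aestronglyMeasurable C
        (Eventually.of_forall fun x => hfC _)
    rw [← integral_convPow hl μ n hh a, ← integral_const_mul, ← integral_sub hi
      ((integrable_of_mem_lipBall hl _ hh a).const_mul L)]
    simpa using norm_integral_le_of_norm_le_const (μ := (convPow μ n : Measure G))
      (f := fun x => f (a * x) - L * h (a * x)) (Eventually.of_forall fun x => hfh (a * x))
  have h1 := abs_le.1 (happrox g)
  have h2 := happrox 1
  simp only [one_mul] at h2
  have h2 := abs_le.1 h2
  have h3 : |L * (average (μ : Measure G))^[n] h g - L * (average (μ : Measure G))^[n] h 1|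
      ≤ ε := by
    rw [← mul_sub, abs_mul, abs_of_pos hL0]
    exact (mul_le_mul_of_nonneg_left (hN n hn h hh) hL0.le).trans_eq (by field_simp)
  have h3 := abs_le.1 h3
  exact abs_le.2 ⟨by linarith, by linarith⟩

theorem uebConvergesToInvariance_of_lipBall (hl : InducesNhdsOne l) (μ : ProbabilityMeasure G)
    (hμ : ∀ (g : G) (ε : ℝ), 0 < ε → ∃ N, ∀ n, N ≤ n → ∀ f ∈ lipBall l,
      |(average (μ : Measure G))^[n] f g - (average (μ : Measure G))^[n] f 1| ≤ ε) :
    UEBConvergesToInvariance atTop fun n : ℕ => toMean (convPow μ n) := by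
  rintro g H ⟨⟨C, hC⟩, hH⟩
  rw [ENNReal.tendsto_nhds_zero]
  intro η hη
  obtain ⟨ε, hε0, hε⟩ : ∃ ε : ℝ, 0 < ε ∧ ENNReal.ofReal ε ≤ η := by
    rcases eq_or_ne η ⊤ with rfl | h
    · exact ⟨1, one_pos, le_top⟩
    · exact ⟨η.toReal, ENNReal.toReal_pos hη.ne' h, (ENNReal.ofReal_toReal h).le⟩
  -- Real and imaginary parts each contribute `3 * (ε / 6)`. The bound `max C 0` below is needed
  -- because `C` may be negative when `H` is empty.
  obtain ⟨U, hU, hUH⟩ := hH (ε / 6) (by positivity)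
  obtain ⟨δ, hδ, hδU⟩ := hl.mem_iff.1 hU
  obtain ⟨N, hN⟩ := exists_forall_abs_integral_convPow_sub_le hl μ g (hμ g) (C := max C 0)
    (ε := ε / 6) (le_max_right _ _) (by positivity) hδ
  filter_upwards [eventually_ge_atTop N] with n hn
  refine iSup₂_le fun f hf => le_trans ?_ hε
  rw [← ofReal_norm]
  refine ENNReal.ofReal_le_ofReal ?_
  have hfb : ∀ x, ‖(f : G →ᵇ ℂ) x‖ ≤ max C 0 := fun x =>
    ((f : G →ᵇ ℂ).norm_coe_le_norm x).trans ((hC f hf).trans (le_max_left _ _))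
  have hfd : ∀ x y, l (x * y⁻¹) < δ → ‖(f : G →ᵇ ℂ) x - (f : G →ᵇ ℂ) y‖ ≤ ε / 6 :=
    fun x y hxy => hUH _ ⟨f, hf, rfl⟩ x y (hδU hxy)
  have hfc : Continuous (f : G →ᵇ ℂ) := (f : G →ᵇ ℂ).continuous
  have hre := hN n hn (fun x => ((f : G →ᵇ ℂ) x).re) (Complex.continuous_re.comp hfc)
    (fun x => (Complex.abs_re_le_norm _).trans (hfb x)) fun x y hxy => by
      rw [← Complex.sub_re]
      exact (Complex.abs_re_le_norm _).trans (hfd x y hxy)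
  have him := hN n hn (fun x => ((f : G →ᵇ ℂ) x).im) (Complex.continuous_im.comp hfc)
    (fun x => (Complex.abs_im_le_norm _).trans (hfb x)) fun x y hxy => by
      rw [← Complex.sub_im]
      exact (Complex.abs_im_le_norm _).trans (hfd x y hxy)
  have hint : ∀ f : RUCB G, Integrable (fun x => (f : G →ᵇ ℂ) x) (convPow μ n : Measure G) :=
    fun f => (f : G →ᵇ ℂ).integrable _
  refine (Complex.norm_le_abs_re_add_abs_im _).trans ?_
  rw [toMean_apply, toMean_apply, Complex.sub_re, Complex.sub_im]
  have e1 := fun f => integral_re (hint f)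
  have e2 := fun f => integral_im (hint f)
  simp only [RCLike.re_to_complex, RCLike.im_to_complex] at e1 e2
  rw [← e1, ← e1, ← e2, ← e2]
  simp only [leftTranslate_apply]
  linarith

end Convergence

end TopGroupAmenability

end

theorem theorem4p6 {G : Type*} [Group G] [TopologicalSpace G] [IsTopologicalGroup G]
    [T2Space G] [SecondCountableTopology G] [MeasurableSpace G] [BorelSpace G] :
    List.TFAE
      [TopGroupAmenability.IsAmenable G,
        ∃ μ : ProbabilityMeasure G,
          (μ : Measure G).support = Set.univ ∧ (μ : Measure G).InnerRegular ∧
            TopGroupAmenability.UEBConvergesToInvariance atTop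
              (fun n : ℕ => TopGroupAmenability.toMean (TopGroupAmenability.convPow μ n)),
        ∃ μ : ProbabilityMeasure G,
          TopGroupAmenability.UEBConvergesToInvariance atTop
            (fun n : ℕ => TopGroupAmenability.toMean (TopGroupAmenability.convPow μ n))] := by
  tfae_have 1 → 2 := fun hG => by
    obtain ⟨l, hl⟩ := TopGroupAmenability.exists_inducesNhdsOne G
    obtain ⟨μ, hsupp, hreg, hμ⟩ := hG.exists_measure hl
    exact ⟨μ, hsupp, hreg, TopGroupAmenability.uebConvergesToInvariance_of_lipBall hl μ hμ⟩
  tfae_have 2 → 3 := fun ⟨μ, _, _, hμ⟩ => ⟨μ, hμ⟩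
  tfae_have 3 → 1 := fun ⟨_, hμ⟩ =>
    TopGroupAmenability.isAmenable_of_uebConvergesToInvariance _ hμ
  tfae_finish
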